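/- **Setting.** There are $n\ge 1$ sellers, seller $i$ offering a product of quality $\theta_i$, with $\theta_1\ge\theta_2\ge\dots\ge\theta_n\ge 0$; the outside option has quality and price $0$. If the platform displays the products in $S\subseteq\{1,\dots,n\}$ and these have prices $p=(p_i)_{i\in S}$, then the multinomial logit (MNL) demand for product $i\in S$ is $$q_i(p)=\frac{e^{\theta_i-p_i}}{1+\sum_{j\in S}e^{\theta_j-p_j}},$$ the revenue of seller $i$ is $r_i(p)=p_i\,q_i(p)$, and the revenue of the market is $\sum_{i\in S}r_i(p)$. In the Bertrand game on $S$ each seller $i\in S$ chooses a price $p_i\ge 0$ and has payoff $r_i$. Let $\overline{re}(S)$ denote the revenue of the market at the pure Nash equilibrium of this game. A display set is *optimal* if it maximizes $\overline{re}$ among all subsets of $\{1,\dots,n\}$ (the empty set has revenue $0$). **Theorem.** Let $n \geq 1$ and $\theta_1\ge\dots\ge\theta_n\ge0$. 1. For every $S$ the Bertrand game on $S$ has exactly one pure Nash equilibrium, so $\overline{re}(S)$ is well defined. 2. There is $k^*\in\{1,\dots,n\}$, determined by $\theta$, such that displaying the top $k^*$ products $\{1,\dots,k^*\}$ is optimal.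 Moreover every optimal display set $S$ consists of the products of highest quality, up to ties: $S$ is non-empty, and $\theta_i\ge\theta_j$ for all $i\in S$ and $j\notin S$. 3. Such a $k^*$ can be computed in linear time by evaluating the revenue of each top-$k$ set: there are one program, not depending on $n$ or $\theta$, and one constant $C$ such that on every input the program halts after at most $C\,n$ steps with output a $k^*$ as in 2, having evaluated exactly the revenues $\overline{re}(\{1\}),\overline{re}(\{1,2\}),\dots,\overline{re}(\{1,\dots,n\})$, in this order and once each. Here a program is a program of a register machine with natural-number registers, real registers and a current display set (initially empty), which is given $n$ and in which each of the following is one step: increasing or copying a register, comparing two registers, jumping, adding one product to the display set, and evaluating $\overline{re}$ of the current display set. -/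

import Mathlib

/-! ### The Bertrand game under multinomial logit demand

There are `n` sellers `i : Fin n` with product qualities `θ i`; the outside option has quality and
price `0`.  `S` is the set of displayed products, and a price profile of the game among the
displayed sellers is a function `p : S → ℝ`. -/

namespace Bertrand

/-- The attraction `a_i = exp (θ_i - p_i)` of a displayed product. -/
noncomputable def attraction {n : ℕ} (θ : Fin n → ℝ) (S : Finset (Fin n)) (p : S → ℝ) (i : S) : ℝ :=
  Real.exp (θ i - p i)

/-- The multinomial logit demand `q_i(p) = a_i / (1 + ∑_{j ∈ S} a_j)`. -/
noncomputable def demand {n : ℕ} (θ : Fin n → ℝ) (S : Finset (Fin n)) (p : S → ℝ) (i : S) : ℝ :=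
  attraction θ S p i / (1 + ∑ j : S, attraction θ S p j)

/-- The revenue `r_i(p) = p_i * q_i(p)` of seller `i`. -/
noncomputable def sellerRevenue {n : ℕ} (θ : Fin n → ℝ) (S : Finset (Fin n)) (p : S → ℝ)
    (i : S) : ℝ :=
  p i * demand θ S p i

/-- The revenue of the market is the total revenue of the displayed sellers. -/
noncomputable def marketRevenue {n : ℕ} (θ : Fin n → ℝ) (S : Finset (Fin n)) (p : S → ℝ) : ℝ :=
  ∑ i : S, sellerRevenue θ S p i

/-- Pure Nash equilibria of the Bertrand game among the sellers in `S`: prices are non-negative,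
and no seller can increase her revenue by changing her own price to another non-negative price. -/
def IsNashEquilibrium {n : ℕ} (θ : Fin n → ℝ) (S : Finset (Fin n)) (p : S → ℝ) : Prop :=
  (∀ i : S, 0 ≤ p i) ∧
    ∀ (i : S) (x : ℝ), 0 ≤ x →
      sellerRevenue θ S (Function.update p i x) i ≤ sellerRevenue θ S p i

open Classical in
/-- The equilibrium revenue of a display set `S`: the market revenue at the Nash equilibrium
(existence and uniqueness of the equilibrium are part of the theorem below). -/
noncomputable def equilibriumRevenue {n : ℕ} (θ : Fin n → ℝ) (S : Finset (Fin n)) : ℝ :=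
  if h : ∃ p : S → ℝ, IsNashEquilibrium θ S p then marketRevenue θ S h.choose else 0

/-- `S` maximizes the equilibrium revenue among all display sets. -/
def IsRevenueOptimal {n : ℕ} (θ : Fin n → ℝ) (S : Finset (Fin n)) : Prop :=
  ∀ T : Finset (Fin n), equilibriumRevenue θ T ≤ equilibriumRevenue θ S

/-- The first `k` products; these are the top `k` by quality when `θ` is non-increasing. -/
def topSet (n k : ℕ) : Finset (Fin n) :=
  Finset.univ.filter fun i => (i : ℕ) < k

/-! ### Search programs with a step count

A register machine of the platform.  It has natural-number registers, real registers, and a current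
display set, initially empty.  It knows the qualities only through the instruction `evaluate`, which
computes the equilibrium revenue of the current display set.  Every instruction is one step. -/

/-- Instructions.  `a`, `b` are names of natural-number registers, `r`, `s` are names of real
registers, and `l` is a line number of the program. -/
inductive Instr : Type
  /-- increase register `a` by one -/
  | succ (a : ℕ)
  /-- copy register `b` into register `a` -/
  | copy (a b : ℕ)
  /-- copy real register `s` into real register `r` -/
  | copyReal (r s : ℕ)
  /-- go to line `l` -/
  | jump (l : ℕ)
  /-- go to line `l` if register `a` is less than register `b` -/
  | jumpIfLt (a b l : ℕ)
  /-- go to line `l` if real register `r` is less than real register `s` -/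
  | jumpIfRealLt (r s l : ℕ)
  /-- add to the display set the single product whose index (counted from `0`) is in register `a` -/
  | display (a : ℕ)
  /-- store the equilibrium revenue of the current display set in real register `r` -/
  | evaluate (r : ℕ)

/-- A program is a finite list of instructions; it halts when it leaves the list. -/
abbrev Program : Type := List Instr

/-- Machine configurations; `evaluated` lists, in order, the display sets evaluated so far.
It only records the computation and cannot be read by a program. -/
structure Config (n : ℕ) : Type where
  /-- the current line -/
  pc : ℕ
  /-- the natural-number registers -/
  nat : ℕ → ℕ
  /-- the real registers -/
  real : ℕ → ℝ
  /-- the current display set -/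
  displayed : Finset (Fin n)
  /-- the display sets evaluated so far -/
  evaluated : List (Finset (Fin n))

/-- Initially register `0` holds the number `n` of products, all other registers hold `0`, and
nothing is displayed. -/
def Config.init (n : ℕ) : Config n where
  pc := 0
  nat := Function.update (fun _ => 0) 0 n
  real := fun _ => 0
  displayed := ∅
  evaluated := []

/-- The effect of one instruction. -/
noncomputable def Instr.exec {n : ℕ} (θ : Fin n → ℝ) (c : Config n) : Instr → Config n
  | .succ a => { c with pc := c.pc + 1, nat := Function.update c.nat a (c.nat a + 1) }
  | .copy a b => { c with pc := c.pc + 1, nat := Function.update c.nat a (c.nat b) }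
  | .copyReal r s => { c with pc := c.pc + 1, real := Function.update c.real r (c.real s) }
  | .jump l => { c with pc := l }
  | .jumpIfLt a b l => { c with pc := if c.nat a < c.nat b then l else c.pc + 1 }
  | .jumpIfRealLt r s l => { c with pc := if c.real r < c.real s then l else c.pc + 1 }
  | .display a =>
      { c with
        pc := c.pc + 1
        displayed := c.displayed ∪ Finset.univ.filter fun i : Fin n => (i : ℕ) = c.nat a }
  | .evaluate r =>
      { c with
        pc := c.pc + 1
        real := Function.update c.real r (equilibriumRevenue θ c.displayed)
        evaluated := c.evaluated ++ [c.displayed] }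

/-- The program has halted: there is no instruction at the current line. -/
def Config.Halted {n : ℕ} (P : Program) (c : Config n) : Prop :=
  P[c.pc]? = none

/-- One step of a program; a halted configuration does not change. -/
noncomputable def step {n : ℕ} (θ : Fin n → ℝ) (P : Program) (c : Config n) : Config n :=
  match P[c.pc]? with
  | some I => I.exec θ c
  | none => c

/-- The configuration after `t` steps. -/
noncomputable def run {n : ℕ} (θ : Fin n → ℝ) (P : Program) (t : ℕ) : Config n :=
  (step θ P)^[t] (Config.init n)

/-- The output of a configuration is the content of register `1`. -/
def Config.output {n : ℕ} (c : Config n) : ℕ := c.nat 1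

end Bertrand

namespace Bertrand

/-! ### The equilibrium market share of a seller -/

/-! At an equilibrium the first-order condition makes the price of a seller with share `q` equal to
`1 / (1 - q)`. So `log q + 1 / (1 - q) = t + θ i`, where `exp t` is the share of the outside option,
and `q = share (t + θ i)`. Equilibria thus correspond to roots of `totalShare θ S t = 1`, which is
increasing in `t`, and the revenue is the sum of the odds `q / (1 - q)`.

For optimality, fix `S` and add one seller of varying quality, with `t` as parameter. Her share is
what `S` and the outside option leave over, so revenue is an explicit function `revenueCurve` of
`t`. It has no local maximum (`not_isLocalMax_revenueCurve`): at a critical point its second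
derivative is positive, by the inequality `rate_pos_of_le_one`. Hence if the entry of `a` does not
lower revenue, replacing `a` by a strictly better seller raises it. An optimal set therefore omits
no product better than one it contains, and exchanging ties turns it into a top set. The program
then only has to compare top sets. -/

theorem continuousOn_log_add_inv :
    ContinuousOn (fun v : ℝ => Real.log v + (1 - v)⁻¹) (Set.Ioo 0 1) := by
  intro v hv
  have h1 : v ≠ 0 := hv.1.ne'
  have h2 : 1 - v ≠ 0 := (sub_pos.2 hv.2).ne'
  exact ((Real.continuousAt_log h1).add
    ((continuousAt_const.sub continuousAt_id).inv₀ h2)).continuousWithinAt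

theorem strictMonoOn_log_add_inv :
    StrictMonoOn (fun v : ℝ => Real.log v + (1 - v)⁻¹) (Set.Ioo 0 1) := by
  intro v hv w hw h
  have h1 := Real.log_lt_log hv.1 h
  have h2 : (1 - v)⁻¹ < (1 - w)⁻¹ := by
    apply inv_strictAnti₀ (sub_pos.2 hw.2); linarith
  exact add_lt_add h1 h2

theorem exists_share (s : ℝ) :
    ∃ v : ℝ, (0 < v ∧ v < 1) ∧ Real.log v + (1 - v)⁻¹ = s := by
  have hlo : ∃ v ∈ Set.Ioo (0 : ℝ) 1, Real.log v + (1 - v)⁻¹ ≤ s := by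
    -- `v ≤ 1/2` bounds the inverse by `2`, and `v ≤ exp (s - 2)` bounds the logarithm by `s - 2`.
    refine ⟨min 2⁻¹ (Real.exp (s - 2)), ⟨by positivity, ?_⟩, ?_⟩
    · exact (min_le_left _ _).trans_lt (by norm_num)
    · have h1 : Real.log (min 2⁻¹ (Real.exp (s - 2))) ≤ s - 2 := by
        rw [Real.log_le_iff_le_exp (by positivity)]
        exact min_le_right _ _
      have h2 : (1 - min 2⁻¹ (Real.exp (s - 2)))⁻¹ ≤ 2 := by
        apply inv_le_of_inv_le₀ two_pos
        have := min_le_left (2⁻¹ : ℝ) (Real.exp (s - 2))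
        linarith
      linarith
  have hhi : ∃ v ∈ Set.Ioo (0 : ℝ) 1, s ≤ Real.log v + (1 - v)⁻¹ := by
    have h0 := abs_nonneg s
    have h1 : (|s| + 2)⁻¹ ≤ 2⁻¹ := inv_anti₀ two_pos (by linarith)
    have h2 : 0 < (|s| + 2)⁻¹ := by positivity
    have h3 : 0 < 1 - (|s| + 2)⁻¹ := by linarith
    -- Here the inverse is `|s| + 2`, while the logarithm is at least `-1` because `v ≥ 1/2`.
    refine ⟨1 - (|s| + 2)⁻¹, ⟨h3, by linarith⟩, ?_⟩
    have h4 := Real.one_sub_inv_le_log_of_pos h3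
    have h5 : (1 - (|s| + 2)⁻¹)⁻¹ ≤ 2 := by
      apply inv_le_of_inv_le₀ two_pos
      linarith
    rw [sub_sub_cancel, inv_inv]
    have := le_abs_self s
    linarith
  obtain ⟨a, ha, has⟩ := hlo
  obtain ⟨b, hb, hbs⟩ := hhi
  obtain ⟨v, hv, h⟩ :=
    isPreconnected_Ioo.intermediate_value ha hb continuousOn_log_add_inv ⟨has, hbs⟩
  exact ⟨v, hv, h⟩

/-- The market share `v ∈ (0, 1)` with `log v + 1 / (1 - v) = s`.  A seller of quality `θ` has the
share `share (t + θ)` in equilibrium if `exp t` is the share of the outside option. -/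
noncomputable def share (s : ℝ) : ℝ := (exists_share s).choose

theorem share_pos (s : ℝ) : 0 < share s := (exists_share s).choose_spec.1.1

theorem share_lt_one (s : ℝ) : share s < 1 := (exists_share s).choose_spec.1.2

theorem share_mem (s : ℝ) : share s ∈ Set.Ioo (0 : ℝ) 1 := ⟨share_pos s, share_lt_one s⟩

theorem log_share_add (s : ℝ) : Real.log (share s) + (1 - share s)⁻¹ = s :=
  (exists_share s).choose_spec.2

theorem share_eq_of_log_add {v s : ℝ} (hv : v ∈ Set.Ioo (0 : ℝ) 1)
    (h : Real.log v + (1 - v)⁻¹ = s) : share s = v :=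
  strictMonoOn_log_add_inv.injOn (share_mem s) hv ((log_share_add s).trans h.symm)

theorem strictMono_share : StrictMono share := by
  intro s t h
  rw [← strictMonoOn_log_add_inv.lt_iff_lt (share_mem s) (share_mem t)]
  simpa only [log_share_add] using h

theorem range_share : Set.range share = Set.Ioo 0 1 :=
  Set.Subset.antisymm (Set.range_subset_iff.2 share_mem)
    fun _ hv => ⟨_, share_eq_of_log_add hv rfl⟩

theorem continuous_share : Continuous share := by
  rw [continuous_iff_continuousAt]
  intro s
  apply (strictMono_share.strictMonoOn Set.univ).continuousAt_of_image_mem_nhds Filter.univ_mem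
  rw [Set.image_univ, range_share]
  exact isOpen_Ioo.mem_nhds (share_mem s)

/-! ### Derivatives of the share and of the odds -/

theorem one_sub_add_sq_pos (v : ℝ) : 0 < 1 - v + v ^ 2 := by
  nlinarith [sq_nonneg (v - 1 / 2)]

/-- The growth rate of the odds `share / (1 - share)`. -/
noncomputable def oddsRate (s : ℝ) : ℝ := share s / (1 - share s + share s ^ 2)

theorem oddsRate_pos (s : ℝ) : 0 < oddsRate s :=
  div_pos (share_pos s) (one_sub_add_sq_pos _)

theorem oddsRate_lt_one (s : ℝ) : oddsRate s < 1 := by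
  have := share_lt_one s
  rw [oddsRate, div_lt_one (one_sub_add_sq_pos _)]
  nlinarith

theorem hasDerivAt_share (s : ℝ) :
    HasDerivAt share (share s * (1 - oddsRate s)) s := by
  have h0 := share_pos s
  have h1 : 0 < 1 - share s := sub_pos.2 (share_lt_one s)
  have hw := one_sub_add_sq_pos (share s)
  have hd : HasDerivAt (fun v : ℝ => Real.log v + (1 - v)⁻¹)
      ((share s)⁻¹ + -(-1) / (1 - share s) ^ 2) (share s) :=
    (Real.hasDerivAt_log h0.ne').add (((hasDerivAt_id _).const_sub 1).inv h1.ne')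
  have h : HasDerivAt share _ s := hd.of_local_left_inverse continuous_share.continuousAt (by positivity)
    (Filter.Eventually.of_forall log_share_add)
  refine h.congr_deriv ?_
  unfold oddsRate
  generalize share s = v at *
  apply inv_eq_of_mul_eq_one_right
  field_simp
  ring

theorem hasDerivAt_odds (s : ℝ) :
    HasDerivAt (fun s => share s / (1 - share s)) (oddsRate s) s := by
  have h0 := share_pos s
  have h1 : 0 < 1 - share s := sub_pos.2 (share_lt_one s)
  have hw := one_sub_add_sq_pos (share s)
  have h := (hasDerivAt_share s).div ((hasDerivAt_share s).const_sub 1) h1.ne'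
  refine h.congr_deriv ?_
  unfold oddsRate
  generalize share s = v at *
  field_simp
  ring

theorem hasDerivAt_oddsRate (s : ℝ) :
    HasDerivAt oddsRate (oddsRate s * (1 - oddsRate s) *
      ((1 - share s ^ 2) / (1 - share s + share s ^ 2))) s := by
  have h0 := share_pos s
  have hw := one_sub_add_sq_pos (share s)
  have h := (hasDerivAt_share s).div
    (((hasDerivAt_share s).const_sub 1).add ((hasDerivAt_share s).pow 2)) hw.ne'
  refine h.congr_deriv ?_
  unfold oddsRate
  simp only [Pi.add_apply, Pi.pow_apply]
  generalize share s = v at *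
  field_simp
  ring

/-- The analytic core: with `v` a share, `E` the total share and `D` its derivative, the expression
is the logarithmic derivative of `growthTerm` times `E + v / E`. It is affine in `D` with slope `1 -
v / E ^ 2`, so the sign of `E ^ 2 - v` decides which bound on `D` is used. -/
theorem rate_pos_of_le_one {v E D : ℝ} (h0 : 0 < v) (h1 : v < 1) (hE : v ≤ E) (hD : 0 < D)
    (hDE : D ≤ E - v / (1 - v + v ^ 2) * v)
    (hf : v / (1 - v + v ^ 2) * (E + v / E) ≤ 1) :
    0 < (1 - v / (1 - v + v ^ 2)) * ((1 - v ^ 2) / (1 - v + v ^ 2)) * (E + v / E) +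
      (D + (v * (1 - v / (1 - v + v ^ 2)) * E - v * D) / E ^ 2) := by
  have hw : 0 < 1 - v + v ^ 2 := by nlinarith [sq_nonneg (v - 1 / 2)]
  have hE0 : 0 < E := h0.trans_le hE
  have hv1 : 0 < 1 - v := sub_pos.2 h1
  set w := 1 - v + v ^ 2 with hwdef
  have hc : 1 - v / w = (1 - v) ^ 2 / w := by rw [hwdef] at hw ⊢; field_simp; ring
  have hm : 0 < (1 - v ^ 2) / w := by
    apply div_pos _ hw; nlinarith
  have hc0 : 0 < 1 - v / w := by rw [hc]; positivity
  rcases le_or_gt v (E ^ 2) with hcase | hcase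
  · have e : D + (v * (1 - v / w) * E - v * D) / E ^ 2 =
        D * ((E ^ 2 - v) / E ^ 2) + v * (1 - v / w) / E := by field_simp; ring
    rw [e]
    have : 0 ≤ D * ((E ^ 2 - v) / E ^ 2) :=
      mul_nonneg hD.le (div_nonneg (sub_nonneg.2 hcase) (by positivity))
    positivity
  -- `hf` is a quadratic inequality in `E`; its discriminant must be nonnegative, which excludes
  -- large `v`. The bound `11/20` is slightly above the root of the cubic below.
  · have hv : v ≤ 11 / 20 := by
      have hq : v * (E ^ 2 + v) ≤ w * E := by
        have : v / w * (E + v / E) = v * (E ^ 2 + v) / (w * E) := by field_simp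
        rw [this, div_le_one (by positivity)] at hf
        exact hf
      have hdisc : 4 * v ^ 3 ≤ w ^ 2 := by
        nlinarith [sq_nonneg (2 * v * E - w)]
      by_contra! hlt
      have hv4 : v ^ 4 ≤ v ^ 3 := pow_le_pow_of_le_one h0.le h1.le (by norm_num)
      have : 0 < 5 * v ^ 3 - 3 * v ^ 2 + 2 * v - 1 := by
        nlinarith [mul_pos h0 (sub_pos.2 hlt), mul_pos (mul_pos h0 h0) (sub_pos.2 hlt)]
      rw [hwdef] at hdisc
      nlinarith
    set k := (1 - v) ^ 2 * (2 - v) / w ^ 2 with hk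
    have hcm : (1 - v / w) * ((1 - v ^ 2) / w) = k - (1 - v / w) := by
      rw [hc, hk, hwdef]; rw [hwdef] at hw; field_simp; ring
    set u := v / w with hu
    have hu0 : 0 < u := by positivity
    -- This is what remains after inserting the upper bound for `D`, multiplying by `E ^ 2` and
    -- dropping `u * E ^ 2 * (E - v) ≥ 0`.
    have main : 0 < k * E ^ 3 - (1 - k) * (v * E) + u * v ^ 2 := by
      rcases le_or_gt v (1 / 3) with h3 | h3
      · have hk1 : 1 ≤ k := by
          rw [hk, one_le_div (by positivity), hwdef]
          have hv4 : v ^ 4 ≤ v ^ 3 := pow_le_pow_of_le_one h0.le h1.le (by norm_num)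
          nlinarith [mul_nonneg h0.le (sub_nonneg.2 h3), pow_pos h0 3]
        have : 0 ≤ (k - 1) * (v * E) := mul_nonneg (by linarith) (by positivity)
        have h4 : 0 < k * E ^ 3 + u * v ^ 2 := by positivity
        linarith
      · have hk1 : 1 / 2 ≤ k := by
          rw [hk, div_le_div_iff₀ two_pos (by positivity), hwdef]
          have hv4 : v ^ 4 ≤ v ^ 3 := pow_le_pow_of_le_one h0.le h1.le (by norm_num)
          nlinarith [mul_nonneg h0.le (sub_nonneg.2 hv),
            mul_nonneg (sq_nonneg v) (sub_nonneg.2 hv)]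
        have hu1 : 1 / 3 < u := by
          rw [hu, div_lt_div_iff₀ (by norm_num) hw, hwdef]; nlinarith
        -- The cubic `E ^ 3` lies above its tangent at `E = v`.
        have hcub : 0 ≤ E ^ 3 - 3 * v ^ 2 * E + 2 * v ^ 3 := by
          have : E ^ 3 - 3 * v ^ 2 * E + 2 * v ^ 3 = (E - v) ^ 2 * (E + 2 * v) := by ring
          rw [this]; positivity
        have h4 : 1 / 2 * (E ^ 3 + v * E) ≤ k * (E ^ 3 + v * E) :=
          mul_le_mul_of_nonneg_right hk1 (by positivity)
        have h5 : 1 / 3 * v ^ 2 < u * v ^ 2 := mul_lt_mul_of_pos_right hu1 (by positivity)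
        have h6 : 0 ≤ 3 * E ^ 3 - 3 * v * E + 2 * v ^ 2 := by
          have h7 : 0 ≤ v * (3 * E ^ 3 - 3 * v * E + 2 * v ^ 2) := by
            nlinarith [mul_pos (sub_pos.2 h3) (pow_pos hE0 3)]
          exact nonneg_of_mul_nonneg_right h7 h0
        linarith
    have hlow : (v - E ^ 2) * D ≤ (v - E ^ 2) * (E - u * v) :=
      mul_le_mul_of_nonneg_left hDE (by linarith)
    have huE : u * v * E ^ 2 ≤ u * E ^ 3 := by
      have : u * E ^ 3 - u * v * E ^ 2 = u * E ^ 2 * (E - v) := by ring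
      have h8 : 0 ≤ u * E ^ 2 * (E - v) := mul_nonneg (by positivity) (by linarith)
      linarith
    rw [hcm]
    have e : (k - (1 - u)) * (E + v / E) + (D + (v * (1 - u) * E - v * D) / E ^ 2) =
        ((k - (1 - u)) * (E ^ 3 + v * E) + v * (1 - u) * E - (v - E ^ 2) * D) / E ^ 2 := by
      field_simp; ring
    rw [e]
    apply div_pos _ (by positivity)
    linarith

/-! ### Market shares and revenue as functions of the share of the outside option -/

variable {ι : Type*}

/-- The sum of the share `exp t` of the outside option and the shares of the sellers in `S`
that respond to it. -/
noncomputable def totalShare (θ : ι → ℝ) (S : Finset ι) (t : ℝ) : ℝ :=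
  Real.exp t + ∑ i ∈ S, share (t + θ i)

/-- The total odds `q / (1 - q)` of the sellers in `S`, which is their total revenue. -/
noncomputable def totalOdds (θ : ι → ℝ) (S : Finset ι) (t : ℝ) : ℝ :=
  ∑ i ∈ S, share (t + θ i) / (1 - share (t + θ i))

theorem strictMono_totalShare (θ : ι → ℝ) (S : Finset ι) : StrictMono (totalShare θ S) := by
  intro s t h
  apply add_lt_add_of_lt_of_le (Real.exp_lt_exp.2 h)
  exact Finset.sum_le_sum fun i _ => (strictMono_share (by linarith)).le

theorem totalShare_pos (θ : ι → ℝ) (S : Finset ι) (t : ℝ) : 0 < totalShare θ S t :=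
  add_pos_of_pos_of_nonneg (Real.exp_pos _) (Finset.sum_nonneg fun _ _ => (share_pos _).le)

theorem share_le_totalShare (θ : ι → ℝ) {S : Finset ι} (t : ℝ) {i : ι} (hi : i ∈ S) :
    share (t + θ i) ≤ totalShare θ S t := by
  have h := Finset.single_le_sum (f := fun i => share (t + θ i))
    (fun j _ => (share_pos (t + θ j)).le) hi
  have := Real.exp_pos t
  exact h.trans (le_add_of_nonneg_left this.le)

theorem continuous_totalShare (θ : ι → ℝ) (S : Finset ι) : Continuous (totalShare θ S) := by
  have := continuous_share
  unfold totalShare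
  fun_prop

/-- The derivative of `totalShare`. -/
noncomputable def totalShareRate (θ : ι → ℝ) (S : Finset ι) (t : ℝ) : ℝ :=
  Real.exp t + ∑ i ∈ S, share (t + θ i) * (1 - oddsRate (t + θ i))

theorem hasDerivAt_totalShare (θ : ι → ℝ) (S : Finset ι) (t : ℝ) :
    HasDerivAt (totalShare θ S) (totalShareRate θ S t) t :=
  (Real.hasDerivAt_exp t).add
    (HasDerivAt.fun_sum fun i _ => (hasDerivAt_share (t + θ i)).comp_add_const t (θ i))

theorem totalShareRate_pos (θ : ι → ℝ) (S : Finset ι) (t : ℝ) : 0 < totalShareRate θ S t :=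
  add_pos_of_pos_of_nonneg (Real.exp_pos _) (Finset.sum_nonneg fun _ _ =>
    mul_nonneg (share_pos _).le (sub_nonneg.2 (oddsRate_lt_one _).le))

theorem totalShareRate_eq (θ : ι → ℝ) (S : Finset ι) (t : ℝ) :
    totalShareRate θ S t =
      totalShare θ S t - ∑ i ∈ S, oddsRate (t + θ i) * share (t + θ i) := by
  rw [totalShareRate, totalShare, add_sub_assoc, ← Finset.sum_sub_distrib]
  congr 1
  exact Finset.sum_congr rfl fun i _ => by ring

theorem totalShareRate_le (θ : ι → ℝ) {S : Finset ι} (t : ℝ) {i : ι} (hi : i ∈ S) :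
    totalShareRate θ S t ≤ totalShare θ S t - oddsRate (t + θ i) * share (t + θ i) := by
  rw [totalShareRate_eq]
  exact sub_le_sub_left (Finset.single_le_sum (f := fun i => oddsRate (t + θ i) * share (t + θ i))
    (fun j _ => (mul_pos (oddsRate_pos (t + θ j)) (share_pos _)).le) hi) _

/-- The market revenue of the sellers in `S` and one more seller, whose quality is such that the
share of the outside option is `exp t`. -/
noncomputable def revenueCurve (θ : ι → ℝ) (S : Finset ι) (t : ℝ) : ℝ :=
  totalOdds θ S t + ((totalShare θ S t)⁻¹ - 1)

/-- The contribution of a seller to the growth of `revenueCurve`. -/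
noncomputable def growthTerm (θ : ι → ℝ) (S : Finset ι) (i : ι) (t : ℝ) : ℝ :=
  oddsRate (t + θ i) * (totalShare θ S t + share (t + θ i) / totalShare θ S t)

theorem growthTerm_pos (θ : ι → ℝ) (S : Finset ι) (i : ι) (t : ℝ) : 0 < growthTerm θ S i t :=
  mul_pos (oddsRate_pos _) (add_pos (totalShare_pos _ _ _)
    (div_pos (share_pos _) (totalShare_pos _ _ _)))

theorem hasDerivAt_revenueCurve (θ : ι → ℝ) (S : Finset ι) (t : ℝ) :
    HasDerivAt (revenueCurve θ S)
      ((∑ i ∈ S, growthTerm θ S i t - 1) / totalShare θ S t) t := by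
  have hE := totalShare_pos θ S t
  have h : HasDerivAt (revenueCurve θ S)
      (∑ i ∈ S, oddsRate (t + θ i) + -totalShareRate θ S t / totalShare θ S t ^ 2) t :=
    (HasDerivAt.fun_sum fun i _ => (hasDerivAt_odds (t + θ i)).comp_add_const t (θ i)).add
      (((hasDerivAt_totalShare θ S t).inv hE.ne').sub_const 1)
  refine h.congr_deriv ?_
  have e : ∑ i ∈ S, growthTerm θ S i t = (∑ i ∈ S, oddsRate (t + θ i)) * totalShare θ S t +
      (∑ i ∈ S, oddsRate (t + θ i) * share (t + θ i)) / totalShare θ S t := by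
    rw [Finset.sum_mul, Finset.sum_div, ← Finset.sum_add_distrib]
    exact Finset.sum_congr rfl fun i _ => by rw [growthTerm]; ring
  rw [e, totalShareRate_eq]
  field_simp
  ring

theorem exists_hasDerivAt_growthTerm (θ : ι → ℝ) {S : Finset ι} {i : ι} (hi : i ∈ S) {t : ℝ}
    (h : growthTerm θ S i t ≤ 1) : ∃ d, 0 < d ∧ HasDerivAt (growthTerm θ S i) d t := by
  have hE := totalShare_pos θ S t
  have hv := (hasDerivAt_share (t + θ i)).comp_add_const t (θ i)
  have hu := (hasDerivAt_oddsRate (t + θ i)).comp_add_const t (θ i)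
  have hT := hasDerivAt_totalShare θ S t
  refine ⟨_, ?_, hu.mul (hT.add (hv.div hT hE.ne'))⟩
  have key := mul_pos (oddsRate_pos (t + θ i)) (rate_pos_of_le_one (share_pos (t + θ i))
    (share_lt_one _) (share_le_totalShare θ t hi) (totalShareRate_pos θ S t)
    (totalShareRate_le θ t hi) h)
  refine key.trans_eq ?_
  simp only [oddsRate]
  ring

/-- At a critical point the positive growth terms sum to `1`, so each is at most `1` and hence has
positive derivative. The second derivative is then positive, so a local maximum would also be a
local minimum and the curve locally constant, which is absurd. -/
theorem not_isLocalMax_revenueCurve (θ : ι → ℝ) (S : Finset ι) (t : ℝ) :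
    ¬ IsLocalMax (revenueCurve θ S) t := by
  intro hmax
  have hE := totalShare_pos θ S t
  have hd : deriv (revenueCurve θ S) =
      fun t => (∑ i ∈ S, growthTerm θ S i t - 1) / totalShare θ S t :=
    funext fun t => (hasDerivAt_revenueCurve θ S t).deriv
  have h0 : ∑ i ∈ S, growthTerm θ S i t = 1 := by
    have := hmax.hasDerivAt_eq_zero (hasDerivAt_revenueCurve θ S t)
    rw [div_eq_zero_iff, or_iff_left hE.ne', sub_eq_zero] at this
    exact this
  have hne : S.Nonempty := by
    rw [Finset.nonempty_iff_ne_empty]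
    rintro rfl
    simp at h0
  have hle : ∀ i ∈ S, growthTerm θ S i t ≤ 1 := fun i hi =>
    (Finset.single_le_sum (f := fun i => growthTerm θ S i t)
      (fun j _ => (growthTerm_pos θ S j t).le) hi).trans_eq h0
  choose! d hd0 hd1 using fun i hi => exists_hasDerivAt_growthTerm θ hi (hle i hi)
  have h2 : HasDerivAt (deriv (revenueCurve θ S)) ((∑ i ∈ S, d i) / totalShare θ S t) t := by
    rw [hd]
    have := ((HasDerivAt.fun_sum hd1).sub_const 1).div (hasDerivAt_totalShare θ S t) hE.ne'
    refine this.congr_deriv ?_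
    rw [h0]
    field_simp
    ring
  have hpos : 0 < (∑ i ∈ S, d i) / totalShare θ S t := div_pos (Finset.sum_pos hd0 hne) hE
  have hmin : IsLocalMin (revenueCurve θ S) t := by
    apply isLocalMin_of_deriv_deriv_pos
    · rwa [h2.deriv]
    · exact hmax.deriv_eq_zero
    · exact (hasDerivAt_revenueCurve θ S t).continuousAt
  have hconst : revenueCurve θ S =ᶠ[nhds t] fun _ => revenueCurve θ S t := by
    filter_upwards [hmax, hmin] with x h3 h4 using le_antisymm h3 h4
  have h5 : deriv (revenueCurve θ S) =ᶠ[nhds t] fun _ => 0 := by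
    simpa using hconst.deriv
  have := h2.unique ((hasDerivAt_const t (0 : ℝ)).congr_of_eventuallyEq h5)
  exact hpos.ne' this

/-- If the revenue does not fall when a seller enters, then it grows with her quality. -/
theorem revenueCurve_lt_of_lt (θ : ι → ℝ) (S : Finset ι) {r s t : ℝ} (hrs : r < s) (hst : s < t)
    (h : revenueCurve θ S t ≤ revenueCurve θ S s) : revenueCurve θ S s < revenueCurve θ S r := by
  by_contra! hr
  have hcont : ContinuousOn (revenueCurve θ S) (Set.Icc r t) := fun x _ =>
    (hasDerivAt_revenueCurve θ S x).continuousAt.continuousWithinAt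
  obtain ⟨m, hm, hmax⟩ := isCompact_Icc.exists_isMaxOn ⟨s, hrs.le, hst.le⟩ hcont
  -- If the maximum is attained at an endpoint, then `s` attains it too.
  have : ∃ x ∈ Set.Ioo r t, IsMaxOn (revenueCurve θ S) (Set.Icc r t) x := by
    by_cases hmI : m ∈ Set.Ioo r t
    · exact ⟨m, hmI, hmax⟩
    · refine ⟨s, ⟨hrs, hst⟩, fun y hy => le_trans (b := revenueCurve θ S m) (hmax hy) ?_⟩
      rcases hm.1.eq_or_lt with rfl | h1
      · exact hr
      · rcases hm.2.eq_or_lt with rfl | h2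
        · exact h
        · exact absurd ⟨h1, h2⟩ hmI
  obtain ⟨x, hx, hxmax⟩ := this
  exact not_isLocalMax_revenueCurve θ S x (hxmax.isLocalMax (Icc_mem_nhds hx.1 hx.2))

/-! ### Nash equilibria -/

/-- The first-order condition makes the revenue at `x` equal to `x - 1`; the comparison with `y`
then reduces to `1 + z < exp z` for `z = y - x ≠ 0`. -/
theorem revenue_lt_of_ne {B θ x y : ℝ} (hB : 0 < B) (hx : B * (x - 1) = Real.exp (θ - x))
    (hy : y ≠ x) :
    y * (Real.exp (θ - y) / (B + Real.exp (θ - y))) <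
      x * (Real.exp (θ - x) / (B + Real.exp (θ - x))) := by
  have hx1 : 0 < x - 1 := pos_of_mul_pos_right (hx ▸ Real.exp_pos _) hB.le
  have hx0 : 0 < x := by linarith
  have e : x * (Real.exp (θ - x) / (B + Real.exp (θ - x))) = x - 1 := by
    rw [← hx]
    have : B + B * (x - 1) = B * x := by ring
    rw [this]
    field_simp
  have ha := Real.exp_pos (θ - y)
  have h1 : y - x + 1 < Real.exp (y - x) := Real.add_one_lt_exp (sub_ne_zero.2 hy)
  have h2 : Real.exp (θ - x) = Real.exp (θ - y) * Real.exp (y - x) := by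
    rw [← Real.exp_add]; ring_nf
  rw [e, ← mul_div_assoc, div_lt_iff₀ (by positivity)]
  have h3 := mul_lt_mul_of_pos_left h1 ha
  rw [← h2, ← hx] at h3
  linarith

theorem share_le_exp (s : ℝ) : share s ≤ Real.exp s := by
  rw [← Real.log_le_iff_le_exp (share_pos s)]
  have h := log_share_add s
  have : 0 < (1 - share s)⁻¹ := inv_pos.2 (sub_pos.2 (share_lt_one s))
  linarith

theorem exists_best_response {B : ℝ} (hB : 0 < B) (θ : ℝ) :
    ∃ x, B * (x - 1) = Real.exp (θ - x) := by
  have hcont : Continuous fun x : ℝ => B * (x - 1) - Real.exp (θ - x) := by fun_prop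
  have h0 : 0 ≤ Real.exp θ / B := by positivity
  obtain ⟨x, -, hx⟩ := intermediate_value_Icc (a := 1) (b := 1 + Real.exp θ / B) (by linarith)
    hcont.continuousOn (show (0 : ℝ) ∈ _ by
      refine ⟨?_, ?_⟩
      · have := Real.exp_pos (θ - 1)
        simp only [sub_self, mul_zero, zero_sub]
        linarith
      · have : Real.exp (θ - (1 + Real.exp θ / B)) ≤ Real.exp θ :=
          Real.exp_le_exp.2 (by linarith)
        rw [add_sub_cancel_left, mul_div_cancel₀ _ hB.ne']
        linarith)
  exact ⟨x, sub_eq_zero.1 hx⟩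

section
variable {n : ℕ} (θ : Fin n → ℝ) (S : Finset (Fin n)) (p : S → ℝ)

theorem attraction_pos (i : S) : 0 < attraction θ S p i := Real.exp_pos _

theorem rivals_pos (i : S) : 0 < 1 + ∑ j ∈ Finset.univ.erase i, attraction θ S p j :=
  add_pos_of_pos_of_nonneg one_pos (Finset.sum_nonneg fun _ _ => (attraction_pos _ _ _ _).le)

theorem rivals_add (i : S) :
    1 + ∑ j ∈ Finset.univ.erase i, attraction θ S p j + attraction θ S p i =
      1 + ∑ j : S, attraction θ S p j := by
  rw [add_assoc, Finset.sum_erase_add _ _ (Finset.mem_univ i)]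

theorem sellerRevenue_update (i : S) (x : ℝ) :
    sellerRevenue θ S (Function.update p i x) i =
      x * (Real.exp (θ i - x) /
        (1 + ∑ j ∈ Finset.univ.erase i, attraction θ S p j + Real.exp (θ i - x))) := by
  have h : ∑ j ∈ Finset.univ.erase i, attraction θ S (Function.update p i x) j =
      ∑ j ∈ Finset.univ.erase i, attraction θ S p j :=
    Finset.sum_congr rfl fun j hj => by
      rw [attraction, Function.update_of_ne (Finset.ne_of_mem_erase hj), attraction]
  have h' : attraction θ S (Function.update p i x) i = Real.exp (θ i - x) := by
    rw [attraction, Function.update_self]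
  rw [sellerRevenue, demand, ← rivals_add θ S _ i, h, h', Function.update_self]

theorem isNashEquilibrium_iff_firstOrder :
    IsNashEquilibrium θ S p ↔ ∀ i : S,
      (1 + ∑ j ∈ Finset.univ.erase i, attraction θ S p j) * (p i - 1) = attraction θ S p i := by
  have hself (i : S) : sellerRevenue θ S p i =
      p i * (Real.exp (θ i - p i) /
        (1 + ∑ j ∈ Finset.univ.erase i, attraction θ S p j + Real.exp (θ i - p i))) := by
    rw [← sellerRevenue_update, Function.update_eq_self]
  constructor
  · rintro ⟨-, h⟩ i
    obtain ⟨x, hx⟩ := exists_best_response (rivals_pos θ S p i) (θ i)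
    have hx1 : 0 < x - 1 := pos_of_mul_pos_right (hx ▸ Real.exp_pos _) (rivals_pos θ S p i).le
    by_cases hpx : p i = x
    · rw [attraction, hpx, hx]
    · have h1 := h i x (by linarith)
      rw [sellerRevenue_update, hself] at h1
      exact absurd h1 (revenue_lt_of_ne (rivals_pos θ S p i) hx hpx).not_ge
  · intro h
    refine ⟨fun i => ?_, fun i x _ => ?_⟩
    · have : 0 < p i - 1 :=
        pos_of_mul_pos_right (h i ▸ attraction_pos θ S p i) (rivals_pos θ S p i).le
      linarith
    · rw [sellerRevenue_update, hself]
      rcases eq_or_ne x (p i) with rfl | hne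
      · exact le_rfl
      · exact (revenue_lt_of_ne (rivals_pos θ S p i) (h i) hne).le

/-! ### Equilibria as roots of `totalShare θ S t = 1` -/

theorem totalShare_eq_sum_coe (t : ℝ) :
    totalShare θ S t = Real.exp t + ∑ i : S, share (t + θ i) := by
  rw [totalShare, Finset.sum_coe_sort S fun i => share (t + θ i)]

variable {θ S p}

theorem IsNashEquilibrium.exists_price_eq (h : IsNashEquilibrium θ S p) :
    ∃ t, totalShare θ S t = 1 ∧ ∀ i : S, p i = (1 - share (t + θ i))⁻¹ := by
  rw [isNashEquilibrium_iff_firstOrder] at h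
  set D := 1 + ∑ j : S, attraction θ S p j with hD
  have hD0 : 0 < D :=
    add_pos_of_pos_of_nonneg one_pos (Finset.sum_nonneg fun _ _ => (attraction_pos _ _ _ _).le)
  have hlt (i : S) : 0 < D - attraction θ S p i := by
    rw [hD, ← rivals_add θ S p i, add_sub_cancel_right]
    exact rivals_pos θ S p i
  have hp (i : S) : p i = (1 - attraction θ S p i / D)⁻¹ := by
    have h1 := h i
    rw [← add_sub_cancel_right (1 + _) (attraction θ S p i), rivals_add, ← hD] at h1
    have h2 := (hlt i).ne'
    have h3 : 1 - attraction θ S p i / D = (D - attraction θ S p i) / D := by field_simp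
    rw [h3, inv_div, eq_div_iff h2]
    linarith
  have hs (i : S) : share (-Real.log D + θ i) = attraction θ S p i / D := by
    apply share_eq_of_log_add
    · refine ⟨div_pos (attraction_pos _ _ _ _) hD0, (div_lt_one hD0).2 ?_⟩
      linarith [hlt i]
    · rw [← hp, Real.log_div (attraction_pos _ _ _ _).ne' hD0.ne', attraction, Real.log_exp]
      ring
  refine ⟨-Real.log D, ?_, fun i => by rw [hs, ← hp]⟩
  rw [totalShare_eq_sum_coe, Real.exp_neg, Real.exp_log hD0, Finset.sum_congr rfl fun i _ => hs i,
    ← Finset.sum_div, ← one_div, ← add_div, ← hD, div_self hD0.ne']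

theorem attraction_eq_of_price_eq {t : ℝ} (hp : ∀ i : S, p i = (1 - share (t + θ i))⁻¹) (i : S) :
    attraction θ S p i = share (t + θ i) * Real.exp (-t) := by
  have h := log_share_add (t + θ i)
  rw [← hp] at h
  rw [attraction, show θ i - p i = Real.log (share (t + θ i)) + -t by linarith, Real.exp_add,
    Real.exp_log (share_pos _)]

theorem one_add_sum_attraction {t : ℝ} (ht : totalShare θ S t = 1)
    (hp : ∀ i : S, p i = (1 - share (t + θ i))⁻¹) :
    1 + ∑ j : S, attraction θ S p j = Real.exp (-t) := by
  rw [Finset.sum_congr rfl fun i _ => attraction_eq_of_price_eq hp i, ← Finset.sum_mul]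
  rw [totalShare_eq_sum_coe, ← eq_sub_iff_add_eq'] at ht
  rw [ht, sub_mul, ← Real.exp_add]
  simp

theorem isNashEquilibrium_of_price_eq {t : ℝ} (ht : totalShare θ S t = 1)
    (hp : ∀ i : S, p i = (1 - share (t + θ i))⁻¹) : IsNashEquilibrium θ S p := by
  rw [isNashEquilibrium_iff_firstOrder]
  intro i
  have h1 : 0 < 1 - share (t + θ i) := sub_pos.2 (share_lt_one _)
  rw [← add_sub_cancel_right (1 + _) (attraction θ S p i), rivals_add,
    one_add_sum_attraction ht hp, attraction_eq_of_price_eq hp, hp]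
  field_simp
  ring

theorem marketRevenue_of_price_eq {t : ℝ} (ht : totalShare θ S t = 1)
    (hp : ∀ i : S, p i = (1 - share (t + θ i))⁻¹) :
    marketRevenue θ S p = totalOdds θ S t := by
  rw [totalOdds, ← Finset.sum_coe_sort S fun i => share (t + θ i) / (1 - share (t + θ i))]
  refine Finset.sum_congr rfl fun i _ => ?_
  have h1 : 0 < 1 - share (t + θ i) := sub_pos.2 (share_lt_one _)
  rw [sellerRevenue, demand, one_add_sum_attraction ht hp, attraction_eq_of_price_eq hp, hp,
    mul_div_cancel_right₀ _ (Real.exp_ne_zero _), inv_mul_eq_div]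

variable (θ S)

theorem totalShare_le (t : ℝ) : totalShare θ S t ≤ Real.exp t * (1 + ∑ i ∈ S, Real.exp (θ i)) := by
  rw [totalShare, mul_add, mul_one, Finset.mul_sum]
  gcongr with i
  rw [← Real.exp_add]
  exact share_le_exp _

theorem exists_totalShare_eq_one : ∃ t, totalShare θ S t = 1 := by
  have hpos : 0 < 1 + ∑ i ∈ S, Real.exp (θ i) :=
    add_pos_of_pos_of_nonneg one_pos (Finset.sum_nonneg fun _ _ => (Real.exp_pos _).le)
  -- The bound `share s ≤ exp s` supplies the left end for the intermediate value theorem; the right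
  -- end is `t = 0`.
  have hN : totalShare θ S (-Real.log (1 + ∑ i ∈ S, Real.exp (θ i))) ≤ 1 := by
    refine (totalShare_le θ S _).trans_eq ?_
    rw [Real.exp_neg, Real.exp_log hpos, inv_mul_cancel₀ hpos.ne']
  have h0 : 1 ≤ totalShare θ S 0 := by
    rw [totalShare, Real.exp_zero]
    exact le_add_of_nonneg_right (Finset.sum_nonneg fun _ _ => (share_pos _).le)
  exact mem_range_of_exists_le_of_exists_ge (continuous_totalShare θ S) ⟨_, hN⟩ ⟨0, h0⟩

theorem existsUnique_isNashEquilibrium : ∃! p : S → ℝ, IsNashEquilibrium θ S p := by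
  obtain ⟨t, ht⟩ := exists_totalShare_eq_one θ S
  refine ⟨fun i => (1 - share (t + θ i))⁻¹, isNashEquilibrium_of_price_eq ht fun _ => rfl,
    fun p hp => ?_⟩
  obtain ⟨s, hs, hps⟩ := hp.exists_price_eq
  obtain rfl := (strictMono_totalShare θ S).injective (hs.trans ht.symm)
  exact funext hps

variable {θ S}

theorem equilibriumRevenue_eq {t : ℝ} (ht : totalShare θ S t = 1) :
    equilibriumRevenue θ S = totalOdds θ S t := by
  have h := (existsUnique_isNashEquilibrium θ S).exists
  rw [equilibriumRevenue, dif_pos h]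
  obtain ⟨s, hs, hps⟩ := h.choose_spec.exists_price_eq
  obtain rfl := (strictMono_totalShare θ S).injective (hs.trans ht.symm)
  exact marketRevenue_of_price_eq ht hps

end

/-! ### The linear search program -/

/-- Display the products one by one, evaluate the revenue each time, and keep the best number of
products so far in register `1`, with its revenue in real register `1`.  Register `2` counts the
displayed products. -/
def searchProgram : Program :=
  [.display 2, .succ 2, .evaluate 0, .jumpIfRealLt 1 0 5, .jump 7, .copyReal 1 0, .copy 1 2,
    .jumpIfLt 2 0 0]

theorem topSet_succ (n k : ℕ) :
    topSet n k ∪ Finset.univ.filter (fun i : Fin n => (i : ℕ) = k) = topSet n (k + 1) := by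
  ext i
  simp [topSet]
  omega

theorem topSet_zero (n : ℕ) : topSet n 0 = ∅ := by
  simp [topSet]

/-- The configuration is at the end of the search loop, after `k` rounds. -/
structure SearchState {n : ℕ} (θ : Fin n → ℝ) (k : ℕ) (c : Config n) : Prop where
  nat_zero : c.nat 0 = n
  nat_two : c.nat 2 = k
  output_le : c.nat 1 ≤ k
  real_one : c.real 1 = equilibriumRevenue θ (topSet n (c.nat 1))
  best : ∀ j ≤ k, equilibriumRevenue θ (topSet n j) ≤ equilibriumRevenue θ (topSet n (c.nat 1))
  displayed : c.displayed = topSet n k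
  evaluated : c.evaluated = (List.range k).map fun j => topSet n (j + 1)

/-- A round takes seven steps when the record improves and six otherwise; line `8` is just past the
end of the program. -/
theorem SearchState.round {n : ℕ} {θ : Fin n → ℝ} {k : ℕ} {c : Config n}
    (h : SearchState θ k c) (hpc : c.pc = 0) :
    ∃ t ≤ 7, SearchState θ (k + 1) ((step θ searchProgram)^[t] c) ∧
      ((step θ searchProgram)^[t] c).pc = if k + 1 < n then 0 else 8 := by
  obtain ⟨pc, nat, real, displayed, evaluated⟩ := c
  obtain ⟨h0, h2, h1, hr, hb, hd, he⟩ := h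
  simp only at h0 h2 h1 hr hb hd he hpc
  subst hpc h2 hd he
  by_cases hlt : equilibriumRevenue θ (topSet n (nat 1)) <
    equilibriumRevenue θ (topSet n (nat 2 + 1))
  · refine ⟨7, le_rfl, ?_, ?_⟩
    · constructor <;>
        simp [step, searchProgram, Instr.exec, topSet_succ, hr, hlt, h0, List.range_succ]
      intro j hj
      rcases Nat.le_succ_iff.1 hj with hj | rfl
      · exact (hb j hj).trans hlt.le
      · exact le_rfl
    · simp [step, searchProgram, Instr.exec, topSet_succ, hr, hlt, h0]
  · refine ⟨6, by norm_num, ?_, ?_⟩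
    · constructor <;>
        simp [step, searchProgram, Instr.exec, topSet_succ, hr, hlt, h0, List.range_succ]
      · omega
      · intro j hj
        rcases Nat.le_succ_iff.1 hj with hj | rfl
        · exact hb j hj
        · exact not_lt.1 hlt
    · simp [step, searchProgram, Instr.exec, topSet_succ, hr, hlt, h0]

theorem exists_searchState {n : ℕ} (θ : Fin n → ℝ) (h0 : equilibriumRevenue θ ∅ = 0) (hn : 0 < n)
    {k : ℕ} (hk : k ≤ n) :
    ∃ t ≤ 7 * k, SearchState θ k (run θ searchProgram t) ∧
      (run θ searchProgram t).pc = if k < n then 0 else 8 := by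
  induction k with
  | zero =>
    -- The initial zero in real register `1` is the revenue of the empty top set, so the invariant
    -- holds before any evaluation.
    refine ⟨0, le_rfl, ?_, by simp [run, Config.init, hn]⟩
    constructor <;> simp [run, Config.init, topSet_zero, h0]
  | succ k ih =>
    obtain ⟨t, ht, hs, hpc⟩ := ih (by omega)
    obtain ⟨u, hu, hs', hpc'⟩ := hs.round (hpc.trans (if_pos (by omega)))
    have e : run θ searchProgram (u + t) = (step θ searchProgram)^[u] (run θ searchProgram t) :=
      Function.iterate_add_apply _ _ _ _
    exact ⟨u + t, by omega, e ▸ hs', e ▸ hpc'⟩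

/-! ### Optimal display sets -/

section
variable {n : ℕ} {θ : Fin n → ℝ} {S : Finset (Fin n)} {a b : Fin n}

theorem totalShare_insert (ha : a ∉ S) (t : ℝ) :
    totalShare θ (insert a S) t = totalShare θ S t + share (t + θ a) := by
  rw [totalShare, totalShare, Finset.sum_insert ha]
  ring

theorem totalOdds_insert (ha : a ∉ S) {t : ℝ} (ht : totalShare θ (insert a S) t = 1) :
    totalOdds θ (insert a S) t = revenueCurve θ S t := by
  have hE := totalShare_pos θ S t
  rw [totalShare_insert ha, ← eq_sub_iff_add_eq'] at ht
  rw [totalOdds, Finset.sum_insert ha, ht, revenueCurve, totalOdds, sub_sub_cancel, add_comm,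
    sub_div, div_self hE.ne', one_div]

/-- Entry, and entry of a better seller even more, shrinks the outside share: `r < s < t`. At `t`
the total share of `S` is `1`, so the curve there gives the revenue of `S` alone. -/
theorem equilibriumRevenue_insert_lt (ha : a ∉ S) (hb : b ∉ S) (hab : θ a < θ b)
    (h : equilibriumRevenue θ S ≤ equilibriumRevenue θ (insert a S)) :
    equilibriumRevenue θ (insert a S) < equilibriumRevenue θ (insert b S) := by
  obtain ⟨t, ht⟩ := exists_totalShare_eq_one θ S
  obtain ⟨s, hs⟩ := exists_totalShare_eq_one θ (insert a S)
  obtain ⟨r, hr⟩ := exists_totalShare_eq_one θ (insert b S)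
  have hst : s < t := by
    rw [← (strictMono_totalShare θ S).lt_iff_lt, ht, ← hs, totalShare_insert ha]
    exact lt_add_of_pos_right _ (share_pos _)
  have hrs : r < s := by
    rw [← (strictMono_totalShare θ (insert b S)).lt_iff_lt, hr, ← hs, totalShare_insert ha,
      totalShare_insert hb]
    gcongr
    exact strictMono_share (by linarith)
  rw [equilibriumRevenue_eq hs, totalOdds_insert ha hs, equilibriumRevenue_eq hr,
    totalOdds_insert hb hr]
  apply revenueCurve_lt_of_lt θ S hrs hst
  rw [equilibriumRevenue_eq ht, equilibriumRevenue_eq hs, totalOdds_insert ha hs] at h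
  rwa [revenueCurve, ht, inv_one, sub_self, add_zero]

theorem equilibriumRevenue_insert_congr (ha : a ∉ S) (hb : b ∉ S) (hab : θ a = θ b) :
    equilibriumRevenue θ (insert a S) = equilibriumRevenue θ (insert b S) := by
  obtain ⟨s, hs⟩ := exists_totalShare_eq_one θ (insert a S)
  have hr : totalShare θ (insert b S) s = 1 := by
    rw [← hs, totalShare_insert ha, totalShare_insert hb, hab]
  rw [equilibriumRevenue_eq hs, totalOdds_insert ha hs, equilibriumRevenue_eq hr,
    totalOdds_insert hb hr]

theorem equilibriumRevenue_empty (θ : Fin n → ℝ) : equilibriumRevenue θ ∅ = 0 := by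
  obtain ⟨t, ht⟩ := exists_totalShare_eq_one θ ∅
  rw [equilibriumRevenue_eq ht, totalOdds, Finset.sum_empty]

theorem equilibriumRevenue_pos (θ : Fin n → ℝ) (hS : S.Nonempty) :
    0 < equilibriumRevenue θ S := by
  obtain ⟨t, ht⟩ := exists_totalShare_eq_one θ S
  rw [equilibriumRevenue_eq ht]
  exact Finset.sum_pos (fun i _ => div_pos (share_pos _) (sub_pos.2 (share_lt_one _))) hS

theorem IsRevenueOptimal.nonempty (hn : 0 < n) (h : IsRevenueOptimal θ S) : S.Nonempty := by
  rw [Finset.nonempty_iff_ne_empty]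
  rintro rfl
  have := h {⟨0, hn⟩}
  rw [equilibriumRevenue_empty] at this
  exact this.not_gt (equilibriumRevenue_pos θ (Finset.singleton_nonempty _))

theorem IsRevenueOptimal.le_of_mem_of_notMem (h : IsRevenueOptimal θ S) (ha : a ∈ S)
    (hb : b ∉ S) : θ b ≤ θ a := by
  by_contra! hab
  have h1 := equilibriumRevenue_insert_lt (S := S.erase a) (Finset.notMem_erase a S)
    (fun hb' => hb (Finset.mem_of_mem_erase hb')) hab
  rw [Finset.insert_erase ha] at h1
  exact (h _).not_gt (h1 (h _))

theorem IsRevenueOptimal.swap (hθ : Antitone θ) (h : IsRevenueOptimal θ S) (ha : a ∈ S)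
    (hb : b ∉ S) (hba : b ≤ a) : IsRevenueOptimal θ (insert b (S.erase a)) := by
  have h1 := equilibriumRevenue_insert_congr (S := S.erase a) (Finset.notMem_erase a S)
    (fun hb' => hb (Finset.mem_of_mem_erase hb')) ((hθ hba).antisymm (h.le_of_mem_of_notMem ha hb))
  rw [Finset.insert_erase ha] at h1
  exact fun T => (h T).trans_eq h1

theorem exists_isRevenueOptimal_topSet (hn : 0 < n) (hθ : Antitone θ) :
    ∃ k ≤ n, IsRevenueOptimal θ (topSet n k) := by
  obtain ⟨S₀, hS₀⟩ := Finite.exists_max (equilibriumRevenue θ)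
  -- Among optimal sets take one with least index sum; exchanging a member for a smaller missing
  -- index would keep optimality and lower the sum.
  obtain ⟨S, hS, hmin⟩ := Set.exists_min_image {S | IsRevenueOptimal θ S}
    (fun S => ∑ i ∈ S, (i : ℕ)) (Set.toFinite _) ⟨S₀, hS₀⟩
  have hlow : ∀ a ∈ S, ∀ b ≤ a, b ∈ S := by
    intro a ha b hba
    by_contra hb
    have h1 := hmin _ (IsRevenueOptimal.swap hθ hS ha hb hba)
    rw [Finset.sum_insert fun hb' => hb (Finset.mem_of_mem_erase hb'),
      ← Finset.sum_erase_add _ _ ha, add_comm] at h1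
    have h2 : a ≤ b := Fin.le_def.2 (by omega)
    exact hb (le_antisymm hba h2 ▸ ha)
  have hne := IsRevenueOptimal.nonempty hn hS
  refine ⟨S.max' hne + 1, (S.max' hne).isLt, ?_⟩
  suffices h : topSet n (S.max' hne + 1) = S from h.symm ▸ hS
  ext i
  simp only [topSet, Finset.mem_filter, Finset.mem_univ, true_and, Nat.lt_succ_iff]
  exact ⟨fun h => hlow _ (S.max'_mem hne) _ h, fun h => S.le_max' i h⟩

end

end Bertrand

theorem mainTheorem2 :
    ∃ (P : Bertrand.Program) (C : ℕ),
      ∀ (n : ℕ) (θ : Fin n → ℝ), 0 < n → (∀ i, 0 ≤ θ i) → Antitone θ →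
        (∀ S : Finset (Fin n), ∃! p : S → ℝ, Bertrand.IsNashEquilibrium θ S p) ∧
        (∀ S : Finset (Fin n), Bertrand.IsRevenueOptimal θ S →
          S.Nonempty ∧ ∀ i ∈ S, ∀ j ∉ S, θ j ≤ θ i) ∧
        ∃ kstar : ℕ, 1 ≤ kstar ∧ kstar ≤ n ∧
          Bertrand.IsRevenueOptimal θ (Bertrand.topSet n kstar) ∧
          ∃ t : ℕ, t ≤ C * n ∧
            (Bertrand.run θ P t).Halted P ∧
            (Bertrand.run θ P t).output = kstar ∧
            (Bertrand.run θ P t).evaluated =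
              (List.range n).map fun k => Bertrand.topSet n (k + 1) := by
  refine ⟨Bertrand.searchProgram, 7, fun n θ hn _ hθ =>
    ⟨Bertrand.existsUnique_isNashEquilibrium θ, fun S hS => ⟨hS.nonempty hn, fun i hi j hj =>
      hS.le_of_mem_of_notMem hi hj⟩, ?_⟩⟩
  obtain ⟨t, ht, hs, hpc⟩ :=
    Bertrand.exists_searchState θ (Bertrand.equilibriumRevenue_empty θ) hn le_rfl
  obtain ⟨k, hk, hopt⟩ := Bertrand.exists_isRevenueOptimal_topSet hn hθ
  have hopt' : Bertrand.IsRevenueOptimal θ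
      (Bertrand.topSet n ((Bertrand.run θ Bertrand.searchProgram t).nat 1)) :=
    fun T => (hopt T).trans (hs.best k hk)
  refine ⟨_, ?_, hs.output_le, hopt', t, ht, ?_, rfl, hs.evaluated⟩
  -- The output is not `0`, since an optimal set is nonempty.
  · obtain ⟨i, hi⟩ := hopt'.nonempty hn
    rw [Bertrand.topSet, Finset.mem_filter] at hi
    omega
  · rw [if_neg (lt_irrefl n)] at hpc
    rw [Bertrand.Config.Halted, hpc]
    rfl
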